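/- Let $r \ge 1$, $q = 2^{2r+1}$, and let $\mathcal W(3,q)$ be the symplectic polar space of $\mathrm{PG}(3,q)$ defined by a non-degenerate alternating bilinear form on $\mathbb F_q^4$; its generators are the totally isotropic lines, and an ovoid of $\mathcal W(3,q)$ is a set of $q^2+1$ points meeting every generator in exactly one point. Let $\mathcal E$ be an elliptic ovoid of $\mathcal W(3,q)$, i.e. an ovoid of $\mathcal W(3,q)$ that is an elliptic quadric of $\mathrm{PG}(3,q)$ (the zero set of a non-degenerate quadratic form of Witt index $1$), and let $\mathcal T$ be a Suzuki--Tits ovoid of $\mathcal W(3,q)$, i.e. an ovoid of $\mathcal W(3,q)$ that is projectively equivalent to $$\{(1,x_2,x_3,x_4) \mid x_2,x_3,x_4\in\mathbb F_q,\ x_2x_3+x_2^{\sigma+2}+x_3^{\sigma}+x_4=0\}\cup\{(0,0,0,1)\},\qquad \sigma=2^{r+1}.$$ Then every plane of $\mathrm{PG}(3,q)$ contains at most four points of $\mathcal E\cap\mathcal T$. If moreover $|\mathcal E\cap\mathcal T| = q+\sqrt{2q}+1$, then some plane contains exactly four points of $\mathcal E\cap\mathcal T$, and $\mathcal E\cap\mathcal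 T$ is an NMDS-set of $\mathrm{PG}(3,q)$, that is: every three distinct points of $\mathcal E\cap\mathcal T$ generate a plane, there exist four distinct points of $\mathcal E\cap\mathcal T$ lying on a plane, and every five distinct points of $\mathcal E\cap\mathcal T$ generate $\mathrm{PG}(3,q)$. -/

import Mathlib

open scoped LinearAlgebra.Projectivization

/-- The projective space `PG(k - 1, q)` of the vector space `F^k`, where `q = |F|`. -/
abbrev PG (F : Type*) [Field F] (k : ℕ) : Type _ := ℙ F (Fin k → F)

/-- The points of a set `X` of `PG(k - 1, q)` that lie in the projective subspace
whose underlying vector subspace is `W`. -/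
def pointsIn {F : Type*} [Field F] {k : ℕ} (X : Set (PG F k))
    (W : Submodule F (Fin k → F)) : Set (PG F k) :=
  {P | P ∈ X ∧ P.submodule ≤ W}

/-- The vector subspace underlying the projective subspace generated by a set of points. -/
def generated {F : Type*} [Field F] {k : ℕ} (X : Set (PG F k)) :
    Submodule F (Fin k → F) :=
  ⨆ P ∈ X, P.submodule

/-- NMDS-sets of `PG(k - 1, q)`: every `k - 1` points generate a hyperplane, some `k` points
lie on a hyperplane, and every `k + 1` points generate the whole space. -/
structure IsNMDSSet {F : Type*} [Field F] {k : ℕ} (X : Set (PG F k)) : Prop where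
  generate_hyperplane : ∀ S : Finset (PG F k), (S : Set (PG F k)) ⊆ X → S.card + 1 = k →
    Module.finrank F (generated (S : Set (PG F k))) + 1 = k
  exists_on_hyperplane : ∃ S : Finset (PG F k), (S : Set (PG F k)) ⊆ X ∧ S.card = k ∧
    ∃ H : Submodule F (Fin k → F), Module.finrank F H + 1 = k ∧ ∀ P ∈ S, P.submodule ≤ H
  generate_top : ∀ S : Finset (PG F k), (S : Set (PG F k)) ⊆ X → S.card = k + 1 →
    generated (S : Set (PG F k)) = ⊤

/-- `B` defines a symplectic polar space `W(3, q)`: it is alternating and nondegenerate. -/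
structure IsSymplectic {F : Type*} [Field F] (B : LinearMap.BilinForm F (Fin 4 → F)) :
    Prop where
  alt : B.IsAlt
  nondegenerate : B.Nondegenerate

/-- Generators of `W(3, q)`: the totally isotropic lines with respect to `B`. -/
structure IsGenerator {F : Type*} [Field F] (B : LinearMap.BilinForm F (Fin 4 → F))
    (L : Submodule F (Fin 4 → F)) : Prop where
  finrank_eq : Module.finrank F L = 2
  isotropic : ∀ x ∈ L, ∀ y ∈ L, B x y = 0

/-- Ovoids of `W(3, q)`: sets of `q ^ 2 + 1` points meeting every generator in exactly
one point. -/
structure IsOvoid {F : Type*} [Field F] (B : LinearMap.BilinForm F (Fin 4 → F))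
    (O : Set (PG F 4)) : Prop where
  ncard_eq : O.ncard = Nat.card F ^ 2 + 1
  existsUnique : ∀ L : Submodule F (Fin 4 → F), IsGenerator B L →
    ∃! P : PG F 4, P ∈ O ∧ P.submodule ≤ L

/-- The quadratic form `Q` on `F^4` is elliptic: it is nondegenerate and has Witt index `1`,
i.e. its maximal totally singular subspaces have vector space dimension `1`. -/
structure IsEllipticForm {F : Type*} [Field F] (Q : QuadraticForm F (Fin 4 → F)) : Prop where
  nondegenerate : (QuadraticMap.polarBilin Q).Nondegenerate
  exists_singular : ∃ v : Fin 4 → F, v ≠ 0 ∧ Q v = 0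
  no_singular_line : ∀ L : Submodule F (Fin 4 → F), Module.finrank F L = 2 →
    ∃ v ∈ L, Q v ≠ 0

/-- Elliptic quadrics of `PG(3, q)`. -/
def IsEllipticQuadric {F : Type*} [Field F] (E : Set (PG F 4)) : Prop :=
  ∃ Q : QuadraticForm F (Fin 4 → F), IsEllipticForm Q ∧
    E = {P | ∀ v ∈ P.submodule, Q v = 0}

/-- Elliptic ovoids of `W(3, q)`: the ovoids of `W(3, q)` that are elliptic quadrics. -/
structure IsEllipticOvoid {F : Type*} [Field F] (B : LinearMap.BilinForm F (Fin 4 → F))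
    (E : Set (PG F 4)) : Prop where
  isOvoid : IsOvoid B E
  isEllipticQuadric : IsEllipticQuadric E

/-- The canonical Suzuki–Tits ovoid of `PG(3, q)`, `q = 2 ^ (2 * r + 1)`: the points
`(1, x₂, x₃, x₄)` with `x₂ x₃ + x₂ ^ (σ + 2) + x₃ ^ σ + x₄ = 0`, where `σ = 2 ^ (r + 1)`,
together with the point `(0, 0, 0, 1)`. -/
def canonicalSuzukiTits (F : Type*) [Field F] (r : ℕ) : Set (PG F 4) :=
  {P | ∃ x₂ x₃ x₄ : F,
      x₂ * x₃ + x₂ ^ (2 ^ (r + 1) + 2) + x₃ ^ (2 ^ (r + 1)) + x₄ = 0 ∧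
      P.submodule = Submodule.span F {![1, x₂, x₃, x₄]}} ∪
    {P | P.submodule = Submodule.span F {![0, 0, 0, 1]}}

/-- Suzuki–Tits ovoids of `W(3, q)`, `q = 2 ^ (2 * r + 1)`: the ovoids of `W(3, q)` that are
projectively equivalent to the canonical Suzuki–Tits ovoid. (The latter is invariant under
field automorphisms, so semilinear equivalences would give nothing more.) -/
structure IsSuzukiTitsOvoid {F : Type*} [Field F] (r : ℕ)
    (B : LinearMap.BilinForm F (Fin 4 → F)) (T : Set (PG F 4)) : Prop where
  isOvoid : IsOvoid B T
  equivalent : ∃ g : (Fin 4 → F) ≃ₗ[F] (Fin 4 → F),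
    T = Projectivization.map g.toLinearMap g.injective '' canonicalSuzukiTits F r

/-! ### Proportionality of symmetric bilinear forms. -/

section Comparison

variable {F V : Type*} [Field F] [AddCommGroup V] [Module F V]

/-! Both ovoids determine the symplectic form up to a scalar. A line through an ovoid point `u` that
leaves the tangent plane at `u` meets the ovoid again, while distinct ovoid points are never
orthogonal for `B`; so `B`-orthogonality to `u` implies tangency at `u`. Hence the polar form of the
elliptic quadric and the form `titsForm` of the canonical Suzuki–Tits ovoid (in suitable
coordinates) are both multiples of `B` (`IsOvoid.polar_eq_mul`, `titsForm_eq_mul`), so the quadric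
polarizes to a nonzero multiple of `titsForm`.

Every plane is the polar plane of a point `p`. Translations and coordinate reversal act transitively
on the Suzuki–Tits ovoid, so a plane meeting it may be moved to contain the point at infinity, and
then to be either tangent there or the plane `x 1 = 0`. The latter cuts the ovoid in a translation
oval, on which the quadric becomes `a + b * s z + d * z ^ 2 + n * z = 0` with `n ≠ 0`. Applying `s`
and eliminating `s z` leaves a nonzero polynomial of degree at most four (`ncard_twisted_roots_le`).

For the NMDS property, no three points of an elliptic quadric are collinear, five coplanar points
are excluded by the bound, and four coplanar points come from a pigeonhole argument on the `q + 1`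
planes through a secant. -/

theorem exists_eq_mul_of_ker_le {f g : V →ₗ[F] F} (h : ∀ x, f x = 0 → g x = 0) :
    ∃ c : F, ∀ x, g x = c * f x := by
  by_cases hf : ∃ y, f y ≠ 0
  · obtain ⟨y, hy⟩ := hf
    refine ⟨g y / f y, fun x => ?_⟩
    have hx : f (x - (f x / f y) • y) = 0 := by
      simp [hy]
    have := h _ hx
    simp only [map_sub, map_smul, smul_eq_mul, sub_eq_zero] at this
    rw [this]
    ring
  · push Not at hf
    exact ⟨0, fun x => by simp [h x (hf x)]⟩

/-- A symmetric form `D` is a multiple of the symmetric form `B` as soon as `D` vanishes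
on `x^⊥` for all `x` in a spanning set of pairwise non-orthogonal vectors. -/
theorem exists_eq_mul_of_perp_le {B D : LinearMap.BilinForm F V} {S : Set V}
    (hS : Submodule.span F S = ⊤) (hB : ∀ x y, B x y = B y x) (hD : ∀ x y, D x y = D y x)
    (hperp : ∀ u ∈ S, ∀ x, B u x = 0 → D u x = 0)
    (hpair : ∀ u ∈ S, ∀ v ∈ S, B u v = 0 → ∃ c : F, v = c • u) :
    ∃ c : F, ∀ x y, D x y = c * B x y := by
  rcases S.eq_empty_or_nonempty with rfl | ⟨u, hu⟩
  · refine ⟨0, fun x y => ?_⟩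
    have hx : x ∈ Submodule.span F (∅ : Set V) := by rw [hS]; trivial
    rw [Submodule.span_empty, Submodule.mem_bot] at hx
    simp [hx]
  obtain ⟨c, hc⟩ := exists_eq_mul_of_ker_le (hperp u hu)
  refine ⟨c, fun x y => ?_⟩
  have hx : x ∈ Submodule.span F S := by rw [hS]; trivial
  induction hx using Submodule.span_induction with
  | mem v hv =>
    by_cases huv : B u v = 0
    · obtain ⟨a, rfl⟩ := hpair u hu v hv huv
      simp only [map_smul, LinearMap.smul_apply, smul_eq_mul, hc]
      ring
    -- The scalars attached to `u` and `v` agree: both compute `D v u`, and `B v u ≠ 0`.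
    · obtain ⟨d, hd⟩ := exists_eq_mul_of_ker_le (hperp v hv)
      have h1 : d * B v u = c * B v u := by
        rw [← hd, hD, hc, hB]
      rw [hd, mul_right_cancel₀ (by rwa [hB]) h1]
  | zero => simp
  | add v w _ _ hv hw => simp only [map_add, LinearMap.add_apply, hv, hw]; ring
  | smul a v _ hv => simp only [map_smul, LinearMap.smul_apply, smul_eq_mul, hv]; ring

end Comparison

/-! ### Elliptic ovoids and their polar forms. -/

section Geometry

variable {F : Type*} [Field F]

theorem Projectivization.mk_eq_mk_of_smul {V : Type*} [AddCommGroup V] [Module F V] {u v : V}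
    (hu : u ≠ 0) (hv : v ≠ 0) {c : F} (h : v = c • u) :
    Projectivization.mk F u hu = Projectivization.mk F v hv := by
  symm
  rw [Projectivization.mk_eq_mk_iff']
  exact ⟨c, h.symm⟩

theorem finrank_span_pair_of_forall_ne_smul {V : Type*} [AddCommGroup V] [Module F V] {u v : V}
    (hu : u ≠ 0) (h : ∀ c : F, v ≠ c • u) :
    Module.finrank F (Submodule.span F {u, v}) = 2 := by
  have hli : LinearIndependent F ![u, v] :=
    (LinearIndependent.pair_iff' hu).2 fun a ha => h a ha.symm
  have := finrank_span_eq_card hli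
  rwa [Matrix.range_cons_cons_empty, Fintype.card_fin] at this

theorem isotropic_span_pair {B : LinearMap.BilinForm F (Fin 4 → F)} (hB : B.IsAlt)
    {u v : Fin 4 → F} (huv : B u v = 0) {x y : Fin 4 → F}
    (hx : x ∈ Submodule.span F {u, v}) (hy : y ∈ Submodule.span F {u, v}) : B x y = 0 := by
  obtain ⟨a, b, rfl⟩ := Submodule.mem_span_pair.1 hx
  obtain ⟨c, d, rfl⟩ := Submodule.mem_span_pair.1 hy
  have hvu : B v u = 0 := by rw [← LinearMap.BilinForm.IsAlt.neg_eq hB, huv, neg_zero]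
  simp [huv, hvu, hB.self_eq_zero]

/-- Orthogonal points of an ovoid of `W(3, q)` are equal. -/
theorem IsOvoid.exists_smul_of_perp {B : LinearMap.BilinForm F (Fin 4 → F)} (hB : B.IsAlt)
    {O : Set (PG F 4)} (hO : IsOvoid B O) {u v : Fin 4 → F} (hu : u ≠ 0) (hv : v ≠ 0)
    (huO : Projectivization.mk F u hu ∈ O) (hvO : Projectivization.mk F v hv ∈ O)
    (huv : B u v = 0) : ∃ c : F, v = c • u := by
  by_contra! h
  obtain ⟨P, -, hP⟩ := hO.existsUnique (Submodule.span F {u, v})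
    ⟨finrank_span_pair_of_forall_ne_smul hu h, fun x hx y hy => isotropic_span_pair hB huv hx hy⟩
  have h1 := hP _ ⟨huO, by
    rw [Projectivization.submodule_mk]; exact Submodule.span_mono (by simp)⟩
  have h2 := hP _ ⟨hvO, by
    rw [Projectivization.submodule_mk]; exact Submodule.span_mono (by simp)⟩
  have h3 := h2.trans h1.symm
  rw [Projectivization.mk_eq_mk_iff'] at h3
  obtain ⟨a, ha⟩ := h3
  exact h a ha.symm

theorem mk_mem_zeroSet {Q : QuadraticForm F (Fin 4 → F)} {u : Fin 4 → F} (hu : u ≠ 0) :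
    Projectivization.mk F u hu ∈ {P : PG F 4 | ∀ v ∈ P.submodule, Q v = 0} ↔ Q u = 0 := by
  simp only [Set.mem_ofPred_eq, Projectivization.submodule_mk, Submodule.mem_span_singleton]
  constructor
  · exact fun h => h u ⟨1, one_smul _ _⟩
  · rintro h _ ⟨a, rfl⟩
    rw [QuadraticMap.map_smul, h, smul_zero]

/-- Independent such vectors would span a totally singular line, against Witt index one. -/
theorem IsEllipticForm.exists_smul_of_polar_eq_zero {Q : QuadraticForm F (Fin 4 → F)}
    (hQ : IsEllipticForm Q) {u v : Fin 4 → F} (hu : u ≠ 0) (hQu : Q u = 0) (hQv : Q v = 0)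
    (huv : QuadraticMap.polar Q u v = 0) : ∃ c : F, v = c • u := by
  by_contra! h
  obtain ⟨w, hw, hQw⟩ := hQ.no_singular_line _ (finrank_span_pair_of_forall_ne_smul hu h)
  obtain ⟨a, b, rfl⟩ := Submodule.mem_span_pair.1 hw
  apply hQw
  rw [QuadraticMap.map_add Q, QuadraticMap.map_smul, QuadraticMap.map_smul, hQu, hQv,
    QuadraticMap.polar_smul_left, QuadraticMap.polar_smul_right, huv]
  simp

theorem map_add_smul_of_singular (Q : QuadraticForm F (Fin 4 → F)) {u x : Fin 4 → F}
    (hu : Q u = 0) (a : F) : Q (x + a • u) = Q x + a * QuadraticMap.polar Q u x := by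
  rw [QuadraticMap.map_add Q, QuadraticMap.map_smul, hu, QuadraticMap.polar_smul_right,
    QuadraticMap.polar_comm]
  simp

/-- A line through a singular `u` not inside the polar hyperplane of `u` carries a second singular
point, so the span contains every vector off that hyperplane; a vector `x` on it is `(x + y) - y`
with `y` off it. -/
theorem IsEllipticForm.span_singular {Q : QuadraticForm F (Fin 4 → F)}
    (hQ : IsEllipticForm Q) : Submodule.span F {v : Fin 4 → F | v ≠ 0 ∧ Q v = 0} = ⊤ := by
  obtain ⟨u, hu, hQu⟩ := hQ.exists_singular
  have hmem : ∀ v, Q v = 0 → v ∈ Submodule.span F {v : Fin 4 → F | v ≠ 0 ∧ Q v = 0} := by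
    intro v hv
    by_cases h : v = 0
    · rw [h]; exact zero_mem _
    · exact Submodule.subset_span ⟨h, hv⟩
  have hnp : ∀ x, QuadraticMap.polar Q u x ≠ 0 →
      x ∈ Submodule.span F {v : Fin 4 → F | v ≠ 0 ∧ Q v = 0} := by
    intro x hx
    have h1 : Q (x + (-(Q x) / QuadraticMap.polar Q u x) • u) = 0 := by
      rw [map_add_smul_of_singular Q hQu]
      field_simp
      ring
    have h2 := Submodule.sub_mem _ (hmem _ h1)
      (Submodule.smul_mem _ (-(Q x) / QuadraticMap.polar Q u x) (hmem u hQu))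
    simpa using h2
  obtain ⟨y, hy⟩ : ∃ y, QuadraticMap.polar Q u y ≠ 0 := by
    by_contra! h
    exact hu (hQ.nondegenerate.1 u fun y => by simpa using h y)
  refine Submodule.eq_top_iff'.2 fun x => ?_
  by_cases hx : QuadraticMap.polar Q u x = 0
  · have h1 : QuadraticMap.polar Q u (x + y) ≠ 0 := by
      rwa [QuadraticMap.polar_add_right, hx, zero_add]
    simpa using Submodule.sub_mem _ (hnp _ h1) (hnp _ hy)
  · exact hnp x hx

/-- The polar form of an elliptic ovoid of `W(3, q)` is a multiple of the form
defining `W(3, q)`. -/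
theorem IsOvoid.polar_eq_mul [CharP F 2] {B : LinearMap.BilinForm F (Fin 4 → F)} (hB : B.IsAlt)
    {Q : QuadraticForm F (Fin 4 → F)} (hQ : IsEllipticForm Q)
    (hO : IsOvoid B {P | ∀ v ∈ P.submodule, Q v = 0}) :
    ∃ c : F, ∀ x y, QuadraticMap.polar Q x y = c * B x y := by
  have key := exists_eq_mul_of_perp_le (B := B) (D := QuadraticMap.polarBilin Q)
    hQ.span_singular (fun x y => by rw [← LinearMap.BilinForm.IsAlt.neg_eq hB, CharTwo.neg_eq])
    (fun x y => by simp [QuadraticMap.polar_comm]) ?_ ?_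
  · simpa using key
  · rintro u ⟨hu, hQu⟩ x hux
    by_contra hD
    simp only [QuadraticMap.polarBilin_apply_apply] at hD
    -- This `a` gives the second singular point of the line through `u` and `x`. It is
    -- `B`-orthogonal to `u`, hence proportional to `u`, which forces `polar Q u x = 0`.
    set a := -(Q x) / QuadraticMap.polar Q u x with ha
    have h1 : Q (x + a • u) = 0 := by
      rw [map_add_smul_of_singular Q hQu, ha]
      field_simp
      ring
    have h2 : x + a • u ≠ 0 := by
      intro h0
      rw [add_eq_zero_iff_eq_neg] at h0
      apply hD
      rw [h0, ← neg_smul, QuadraticMap.polar_smul_right, QuadraticMap.polar_self, hQu]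
      simp
    obtain ⟨c, hc⟩ := hO.exists_smul_of_perp hB hu h2 ((mk_mem_zeroSet hu).2 hQu)
      ((mk_mem_zeroSet h2).2 h1) (by simp [hux, hB.self_eq_zero])
    apply hD
    rw [eq_sub_of_add_eq hc, ← sub_smul, QuadraticMap.polar_smul_right,
      QuadraticMap.polar_self, hQu]
    simp
  · rintro u ⟨hu, hQu⟩ v ⟨hv, hQv⟩ huv
    exact hO.exists_smul_of_perp hB hu hv ((mk_mem_zeroSet hu).2 hQu)
      ((mk_mem_zeroSet hv).2 hQv) huv

end Geometry

/-! ### The Suzuki–Tits ovoid, its symmetries and its symplectic form. -/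

section SuzukiTits

variable {F : Type*} [Field F]

/-- The affine points `(1, x, y, x y + x ^ (s + 2) + y ^ s)` of the Suzuki–Tits ovoid defined
by the endomorphism `s`. -/
def titsVec (s : F →+* F) (x y : F) : Fin 4 → F :=
  ![1, x, y, x * y + s x * x ^ 2 + s y]

/-- The point at infinity of the Suzuki–Tits ovoid. -/
def titsInfty (F : Type*) [Field F] : Fin 4 → F := ![0, 0, 0, 1]

/-- The nonzero vectors spanning a point of the Suzuki–Tits ovoid defined by `s`. -/
def OnTits (s : F →+* F) (v : Fin 4 → F) : Prop :=
  v ≠ 0 ∧ ((∃ (x y c : F), v = c • titsVec s x y) ∨ ∃ c : F, v = c • titsInfty F)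

/-- The alternating form `x₀ y₃ + x₃ y₀ + x₁ y₂ + x₂ y₁` in characteristic two. -/
def titsForm (F : Type*) [Field F] : LinearMap.BilinForm F (Fin 4 → F) :=
  LinearMap.mk₂ F (fun x y => x 0 * y 3 + x 3 * y 0 + x 1 * y 2 + x 2 * y 1)
    (by intros; simp only [Pi.add_apply]; ring)
    (by intros; simp only [Pi.smul_apply, smul_eq_mul]; ring)
    (by intros; simp only [Pi.add_apply]; ring)
    (by intros; simp only [Pi.smul_apply, smul_eq_mul]; ring)

theorem titsForm_apply (x y : Fin 4 → F) :
    titsForm F x y = x 0 * y 3 + x 3 * y 0 + x 1 * y 2 + x 2 * y 1 := rfl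

theorem titsForm_comm (x y : Fin 4 → F) : titsForm F x y = titsForm F y x := by
  simp only [titsForm_apply]; ring

theorem titsVec_ne_zero (s : F →+* F) (x y : F) : titsVec s x y ≠ 0 := fun h => by
  simpa [titsVec] using congrFun h 0

theorem titsInfty_ne_zero : titsInfty F ≠ 0 := fun h => by
  simpa [titsInfty] using congrFun h 3

theorem OnTits.smul_iff {s : F →+* F} {v : Fin 4 → F} {a : F} (ha : a ≠ 0) :
    OnTits s (a • v) ↔ OnTits s v := by
  constructor
  · rintro ⟨h0, ⟨x, y, c, h⟩ | ⟨c, h⟩⟩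
    · exact ⟨fun hv => h0 (by simp [hv]), Or.inl ⟨x, y, a⁻¹ * c, by
        rw [mul_smul, ← h, inv_smul_smul₀ ha]⟩⟩
    · exact ⟨fun hv => h0 (by simp [hv]), Or.inr ⟨a⁻¹ * c, by
        rw [mul_smul, ← h, inv_smul_smul₀ ha]⟩⟩
  · rintro ⟨h0, ⟨x, y, c, rfl⟩ | ⟨c, rfl⟩⟩
    · exact ⟨smul_ne_zero ha h0, Or.inl ⟨x, y, a * c, (mul_smul _ _ _).symm⟩⟩
    · exact ⟨smul_ne_zero ha h0, Or.inr ⟨a * c, (mul_smul _ _ _).symm⟩⟩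

theorem onTits_titsVec (s : F →+* F) (x y : F) : OnTits s (titsVec s x y) :=
  ⟨titsVec_ne_zero s x y, Or.inl ⟨x, y, 1, (one_smul _ _).symm⟩⟩

theorem onTits_titsInfty (s : F →+* F) : OnTits s (titsInfty F) :=
  ⟨titsInfty_ne_zero, Or.inr ⟨1, (one_smul _ _).symm⟩⟩

theorem span_onTits (s : F →+* F) : Submodule.span F {v | OnTits s v} = ⊤ := by
  refine Submodule.eq_top_iff'.2 fun x => ?_
  have hx : x = (x 0 - x 1 - x 2) • titsVec s 0 0 + x 2 • titsVec s 0 1 + x 1 • titsVec s 1 0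
      + (x 3 - x 1 - x 2) • titsInfty F := by
    ext i
    fin_cases i <;> simp [titsVec, titsInfty]
    ring
  rw [hx]
  have h (x y : F) : titsVec s x y ∈ Submodule.span F {v | OnTits s v} :=
    Submodule.subset_span (onTits_titsVec s x y)
  exact add_mem (add_mem (add_mem (Submodule.smul_mem _ _ (h _ _)) (Submodule.smul_mem _ _ (h _ _)))
    (Submodule.smul_mem _ _ (h _ _)))
    (Submodule.smul_mem _ _ (Submodule.subset_span (onTits_titsInfty s)))

/-- The linear symmetries of the Suzuki–Tits ovoid preserving the form `titsForm`. -/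
structure IsTitsSymmetry (s : F →+* F) (g : (Fin 4 → F) ≃ₗ[F] (Fin 4 → F)) : Prop where
  onTits_iff : ∀ v, OnTits s (g v) ↔ OnTits s v
  form_apply : ∀ x y, titsForm F (g x) (g y) = titsForm F x y

theorem IsTitsSymmetry.trans {s : F →+* F} {g h : (Fin 4 → F) ≃ₗ[F] (Fin 4 → F)}
    (hg : IsTitsSymmetry s g) (hh : IsTitsSymmetry s h) : IsTitsSymmetry s (g.trans h) :=
  ⟨fun v => (hh.onTits_iff _).trans (hg.onTits_iff v),
    fun x y => (hh.form_apply _ _).trans (hg.form_apply x y)⟩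

theorem OnTits.map {s : F →+* F} {g : (Fin 4 → F) ≃ₗ[F] (Fin 4 → F)}
    {v : Fin 4 → F} (hv : OnTits s v) (h1 : ∀ x y, OnTits s (g (titsVec s x y)))
    (h2 : OnTits s (g (titsInfty F))) : OnTits s (g v) := by
  obtain ⟨h0, ⟨x, y, c, rfl⟩ | ⟨c, rfl⟩⟩ := hv
  · rw [map_smul, OnTits.smul_iff (left_ne_zero_of_smul h0)]
    exact h1 x y
  · rw [map_smul, OnTits.smul_iff (left_ne_zero_of_smul h0)]
    exact h2

/-- The reversal of coordinates. -/
def titsSwap (F : Type*) [Field F] : (Fin 4 → F) ≃ₗ[F] (Fin 4 → F) :=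
  LinearEquiv.funCongrLeft F F Fin.revPerm

theorem titsSwap_apply (x : Fin 4 → F) : titsSwap F x = ![x 3, x 2, x 1, x 0] := by
  ext i
  fin_cases i <;> rfl

/-- The translations of the Suzuki–Tits ovoid. -/
def titsShift (s : F →+* F) (u v : F) : (Fin 4 → F) ≃ₗ[F] (Fin 4 → F) where
  toFun x := ![x 0, x 1 + u * x 0, x 2 + s u * x 1 + v * x 0,
    x 3 + u * x 2 + (v + s u * u) * x 1 + (u * v + s u * u ^ 2 + s v) * x 0]
  map_add' x y := by ext i; fin_cases i <;> simp <;> ring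
  map_smul' a x := by ext i; fin_cases i <;> simp <;> ring
  invFun x := ![x 0, x 1 - u * x 0, x 2 - s u * (x 1 - u * x 0) - v * x 0,
    x 3 - u * (x 2 - s u * (x 1 - u * x 0) - v * x 0) - (v + s u * u) * (x 1 - u * x 0) -
      (u * v + s u * u ^ 2 + s v) * x 0]
  left_inv x := by ext i; fin_cases i <;> simp <;> ring
  right_inv x := by ext i; fin_cases i <;> simp <;> ring

theorem titsShift_apply (s : F →+* F) (u v : F) (x : Fin 4 → F) :
    titsShift s u v x = ![x 0, x 1 + u * x 0, x 2 + s u * x 1 + v * x 0,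
    x 3 + u * x 2 + (v + s u * u) * x 1 + (u * v + s u * u ^ 2 + s v) * x 0] := rfl

theorem titsShift_titsInfty (s : F →+* F) (u v : F) :
    titsShift s u v (titsInfty F) = titsInfty F := by
  ext i
  fin_cases i <;> simp [titsShift_apply, titsInfty]

variable [CharP F 2]

theorem titsShift_titsVec {s : F →+* F} (hs : ∀ x, s (s x) = x ^ 2) (u v x y : F) :
    titsShift s u v (titsVec s x y) = titsVec s (x + u) (y + s u * x + v) := by
  have h2 : (2 : F) = 0 := CharTwo.two_eq_zero
  ext i
  fin_cases i
  · simp [titsShift_apply, titsVec]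
  · simp [titsShift_apply, titsVec]
  · simp [titsShift_apply, titsVec]
  · simp only [titsShift_apply, titsVec, map_add, map_mul, hs, Fin.reduceFinMk, Matrix.cons_val]
    grind

theorem isTitsSymmetry_titsShift {s : F →+* F} (hs : ∀ x, s (s x) = x ^ 2) (u v : F) :
    IsTitsSymmetry s (titsShift s u v) := by
  have h2 : (2 : F) = 0 := CharTwo.two_eq_zero
  have hmap (u v : F) {x : Fin 4 → F} (hx : OnTits s x) : OnTits s (titsShift s u v x) :=
    hx.map (fun x y => by rw [titsShift_titsVec hs]; exact onTits_titsVec _ _ _)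
      (by rw [titsShift_titsInfty]; exact onTits_titsInfty s)
  -- In characteristic two, the inverse translation has parameters `u` and `v + s u * u`.
  have hinv (x : Fin 4 → F) : titsShift s u (v + s u * u) (titsShift s u v x) = x := by
    ext i
    fin_cases i <;>
      simp only [titsShift_apply, map_add, map_mul, hs, Fin.reduceFinMk, Matrix.cons_val,
        Fin.zero_eta, Fin.mk_one] <;> grind
  refine ⟨fun x => ⟨fun hx => ?_, hmap u v⟩, fun x y => ?_⟩
  · rw [← hinv x]
    exact hmap _ _ hx
  · simp only [titsForm_apply, titsShift_apply, Matrix.cons_val]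
    grind

theorem isTitsSymmetry_titsSwap {s : F →+* F} (hs : ∀ x, s (s x) = x ^ 2) :
    IsTitsSymmetry s (titsSwap F) := by
  have h2 : (2 : F) = 0 := CharTwo.two_eq_zero
  have hmap {x : Fin 4 → F} (hx : OnTits s x) : OnTits s (titsSwap F x) := by
    refine hx.map (fun x y => ?_) ?_
    · set z := x * y + s x * x ^ 2 + s y with hz
      have hsz : s z = s x * s y + x ^ 2 * s x ^ 2 + y ^ 2 := by
        rw [hz]; simp only [map_add, map_mul, map_pow, hs]
      have hsw : titsSwap F (titsVec s x y) = ![z, y, x, 1] := by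
        rw [titsSwap_apply]; rfl
      rw [hsw]
      -- The last coordinate vanishes only at `x = y = 0`, whose point is swapped to infinity: `z =
      -- 0` and `s z = 0` give `y * (y - s x * x) = 0`, and both factors lead to `x * y = 0`.
      -- Otherwise the reversed vector is `z` times an affine ovoid point.
      by_cases h0 : z = 0
      · have hy : y ^ 2 = s x * (s y + x ^ 2 * s x) := by grind
        have hxy : x * y = 0 := by
          have : s y + x ^ 2 * s x = x * y := by grind
          have h3 : y * (y - s x * x) = 0 := by grind
          rcases mul_eq_zero.1 h3 with h | h
          · rw [h, mul_zero]
          · have h4 : y = s x * x := sub_eq_zero.1 h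
            have h5 : s y = x ^ 2 * s x := by rw [h4, map_mul, hs]
            grind
        have hx0 : x = 0 ∧ y = 0 := by
          rcases mul_eq_zero.1 hxy with h | h
          · subst h
            simp only [map_zero, zero_mul, mul_zero, zero_pow two_ne_zero] at hy
            exact ⟨rfl, pow_eq_zero_iff two_ne_zero |>.1 hy⟩
          · subst h
            simp only [map_zero, zero_add, mul_zero, add_zero] at hz
            rw [h0] at hz
            rcases mul_eq_zero.1 hz.symm with h | h
            · exact ⟨(map_eq_zero s).1 h, rfl⟩
            · exact ⟨pow_eq_zero_iff two_ne_zero |>.1 h, rfl⟩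
        rw [h0, hx0.1, hx0.2]
        exact onTits_titsInfty s
      · have key : titsVec s (y / z) (x / z) = z⁻¹ • ![z, y, x, 1] := by
          have hsz0 : s z ≠ 0 := (map_ne_zero s).2 h0
          ext i
          fin_cases i
          · simp [titsVec, h0]
          · simp [titsVec]; field_simp
          · simp [titsVec]; field_simp
          · simp only [titsVec, map_div₀, Fin.reduceFinMk, Matrix.cons_val, Pi.smul_apply,
              smul_eq_mul]
            field_simp
            rw [hsz]
            grind
        rw [← OnTits.smul_iff (inv_ne_zero h0), ← key]
        exact onTits_titsVec _ _ _
    · have : titsSwap F (titsInfty F) = titsVec s 0 0 := by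
        ext i
        fin_cases i <;> simp [titsSwap_apply, titsInfty, titsVec]
      rw [this]
      exact onTits_titsVec _ _ _
  refine ⟨fun x => ⟨fun hx => ?_, hmap⟩, fun x y => ?_⟩
  · have h := hmap hx
    have : titsSwap F (titsSwap F x) = x := by
      ext i
      fin_cases i <;> simp [titsSwap_apply]
    rwa [this] at h
  · simp only [titsForm_apply, titsSwap_apply, Matrix.cons_val]
    ring

/-- The symmetries of the Suzuki–Tits ovoid are transitive on its points. -/
theorem OnTits.exists_symmetry {s : F →+* F} (hs : ∀ x, s (s x) = x ^ 2) {v : Fin 4 → F}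
    (hv : OnTits s v) : ∃ g, IsTitsSymmetry s g ∧ ∃ c : F, c ≠ 0 ∧ g v = c • titsInfty F := by
  obtain ⟨h0, ⟨x, y, c, rfl⟩ | ⟨c, rfl⟩⟩ := hv
  · refine ⟨(titsShift s x (y + s x * x)).trans (titsSwap F),
      (isTitsSymmetry_titsShift hs _ _).trans (isTitsSymmetry_titsSwap hs), c,
      left_ne_zero_of_smul h0, ?_⟩
    rw [map_smul, LinearEquiv.trans_apply, titsShift_titsVec hs]
    have h1 : x + x = 0 := CharTwo.add_self_eq_zero x
    have h3 : y + s x * x + (y + s x * x) = 0 := CharTwo.add_self_eq_zero _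
    rw [h1, h3]
    congr 1
    ext i
    fin_cases i <;> simp [titsSwap_apply, titsInfty, titsVec]
  · exact ⟨LinearEquiv.refl F _, ⟨fun _ => Iff.rfl, fun _ _ => rfl⟩, c,
      left_ne_zero_of_smul h0, rfl⟩

/-- A line through a point of the Suzuki–Tits ovoid and outside its tangent plane is a secant. -/
theorem OnTits.exists_secant {s : F →+* F} (hs : ∀ x, s (s x) = x ^ 2) {v x : Fin 4 → F}
    (hv : OnTits s v) (hx : titsForm F v x ≠ 0) :
    ∃ a b : F, b ≠ 0 ∧ OnTits s (a • v + b • x) := by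
  obtain ⟨g, hg, c, hc, hgv⟩ := hv.exists_symmetry hs
  rw [← hg.form_apply, hgv] at hx
  have hx0 : g x 0 ≠ 0 := by
    intro h
    apply hx
    simp [titsForm_apply, titsInfty, h]
  set z := g x with hz
  -- With `v` moved to infinity, the line fixes the affine coordinates `z 1 / z 0` and `z 2 / z 0`;
  -- only the last coordinate has to be corrected to land on the ovoid.
  refine ⟨((titsVec s (z 1 / z 0) (z 2 / z 0)) 3 - z 3 / z 0) / c, (z 0)⁻¹, inv_ne_zero hx0, ?_⟩
  rw [← hg.onTits_iff, map_add, map_smul, map_smul, hgv, ← hz]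
  convert onTits_titsVec s (z 1 / z 0) (z 2 / z 0) using 1
  ext i
  fin_cases i <;> simp [titsVec, titsInfty] <;> field_simp
  ring

theorem titsForm_self (x : Fin 4 → F) : titsForm F x x = 0 := by
  have h2 : (2 : F) = 0 := CharTwo.two_eq_zero
  simp only [titsForm_apply]; grind

/-- The Suzuki–Tits ovoid determines its symplectic form up to a scalar. -/
theorem titsForm_eq_mul {s : F →+* F} (hs : ∀ x, s (s x) = x ^ 2)
    {B : LinearMap.BilinForm F (Fin 4 → F)} (hB : B.IsAlt)
    (h : ∀ u v, OnTits s u → OnTits s v → B u v = 0 → ∃ c : F, v = c • u) :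
    ∃ c : F, ∀ x y, titsForm F x y = c * B x y := by
  refine exists_eq_mul_of_perp_le (span_onTits s)
    (fun x y => by rw [← LinearMap.BilinForm.IsAlt.neg_eq hB, CharTwo.neg_eq]) titsForm_comm ?_
    (fun u hu v hv => h u v hu hv)
  intro u hu x hux
  by_contra hx
  obtain ⟨a, b, hb, hR⟩ := OnTits.exists_secant hs hu hx
  obtain ⟨c, hc⟩ := h u _ hu hR (by simp [hux, hB.self_eq_zero])
  have h1 : titsForm F u (a • u + b • x) = 0 := by
    rw [hc, map_smul, titsForm_self, smul_zero]
  rw [map_add, map_smul, map_smul, titsForm_self, smul_zero, zero_add, smul_eq_mul] at h1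
  exact (mul_ne_zero hb hx) h1

end SuzukiTits

/-! ### Counting points of the intersection in a plane. -/

section Count

variable {F : Type*} [Field F]

theorem ncard_quartic_roots_le [DecidableEq F] {A B C D : F} (hC : C ≠ 0) :
    {z : F | A * z ^ 4 + B * z ^ 2 + C * z + D = 0}.ncard ≤ if A = 0 then 2 else 4 := by
  open Polynomial in
  set p : F[X] := Polynomial.C A * X ^ 4 + Polynomial.C B * X ^ 2 + Polynomial.C C * X +
    Polynomial.C D with hp
  have hp0 : p ≠ 0 := by
    intro h
    have h1 : p.coeff 1 = C := by
      rw [hp]; simp [Polynomial.coeff_C]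
    rw [h, Polynomial.coeff_zero] at h1
    exact hC h1.symm
  have hdeg : p.natDegree ≤ if A = 0 then 2 else 4 := by
    split_ifs with hA
    · rw [hp, hA, map_zero, zero_mul, zero_add]
      compute_degree
    · rw [hp]
      compute_degree
  have hsub : {z : F | A * z ^ 4 + B * z ^ 2 + C * z + D = 0} ⊆ p.roots.toFinset := by
    intro z hz
    simp only [Finset.mem_coe, Multiset.mem_toFinset, Polynomial.mem_roots hp0,
      Polynomial.IsRoot.def]
    rw [hp]
    simpa using hz
  calc _ ≤ (p.roots.toFinset : Set F).ncard := Set.ncard_le_ncard hsub (Finset.finite_toSet _)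
    _ = p.roots.toFinset.card := Set.ncard_coe_finset _
    _ ≤ p.roots.card := Multiset.toFinset_card_le _
    _ ≤ p.natDegree := Polynomial.card_roots' p
    _ ≤ _ := hdeg

variable [CharP F 2]

/-- When `b ≠ 0`, apply `s` to the equation and substitute for `b * s z`: squaring is additive, so
the result is a quartic without cubic term, with linear coefficient `s n * b * n ≠ 0` and leading
coefficient `s c * c ^ 2`. The sharper bound for `c = 0` leaves room for the point at infinity,
singular exactly in that case. -/
theorem ncard_twisted_roots_le [DecidableEq F] [Finite F] {s : F →+* F} (hs : ∀ x, s (s x) = x ^ 2)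
    {a b c n : F} (hn : n ≠ 0) :
    {z : F | a + b * s z + c * z ^ 2 + n * z = 0}.ncard ≤ if c = 0 then 2 else 4 := by
  have h2 : (2 : F) = 0 := CharTwo.two_eq_zero
  by_cases hb : b = 0
  · have h := ncard_quartic_roots_le (A := 0) (B := c) (C := n) (D := a) hn
    rw [if_pos rfl] at h
    have heq : {z : F | a + b * s z + c * z ^ 2 + n * z = 0} =
        {z : F | 0 * z ^ 4 + c * z ^ 2 + n * z + a = 0} := by
      ext z
      simp only [Set.mem_ofPred_eq, hb]
      ring_nf
    rw [heq]
    split_ifs <;> omega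
  · have hC : s n * b * n ≠ 0 := mul_ne_zero (mul_ne_zero ((map_ne_zero s).2 hn) hb) hn
    have h := ncard_quartic_roots_le (A := s c * c ^ 2)
      (B := s c * n ^ 2 + s n * b * c + b ^ 2 * s b) (C := s n * b * n)
      (D := s c * a ^ 2 + s n * b * a + s a * b ^ 2) hC
    have hA : s c * c ^ 2 = 0 ↔ c = 0 := by simp
    simp only [hA] at h
    refine (Set.ncard_le_ncard ?_ (Set.toFinite _)).trans h
    intro z hz
    simp only [Set.mem_ofPred_eq] at hz ⊢
    have h1 : b * s z = c * z ^ 2 + n * z + a := by grind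
    have h3 : s b * z ^ 2 = s c * s z ^ 2 + s n * s z + s a := by
      have := congrArg s h1
      simpa only [map_add, map_mul, map_pow, hs] using this
    have h4 : b ^ 2 * (s b * z ^ 2) =
        s c * (b * s z) ^ 2 + s n * b * (b * s z) + s a * b ^ 2 := by
      rw [h3]; ring
    rw [h1] at h4
    grind

/-- The points of the Suzuki–Tits ovoid that are singular for `Q` and lie in the polar plane
of `p`. -/
def titsSection (s : F →+* F) (Q : QuadraticForm F (Fin 4 → F)) (p : Fin 4 → F) :
    Set (PG F 4) :=
  {P | OnTits s P.rep ∧ Q P.rep = 0 ∧ titsForm F p P.rep = 0}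

omit [CharP F 2] in
theorem mk_mem_titsSection {s : F →+* F} {Q : QuadraticForm F (Fin 4 → F)} {p v : Fin 4 → F}
    (hv : v ≠ 0) : Projectivization.mk F v hv ∈ titsSection s Q p ↔
      OnTits s v ∧ Q v = 0 ∧ titsForm F p v = 0 := by
  obtain ⟨a, ha⟩ := Projectivization.exists_smul_eq_mk_rep F v hv
  have ha0 : (a : F) ≠ 0 := a.ne_zero
  rw [titsSection, Set.mem_ofPred_eq, ← ha, Units.smul_def, OnTits.smul_iff ha0,
    QuadraticMap.map_smul, map_smul]
  simp

omit [CharP F 2] in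
theorem IsTitsSymmetry.ncard_titsSection_le [Finite F] {s : F →+* F}
    {g : (Fin 4 → F) ≃ₗ[F] (Fin 4 → F)} (hg : IsTitsSymmetry s g)
    (Q : QuadraticForm F (Fin 4 → F)) (p : Fin 4 → F) :
    (titsSection s Q p).ncard ≤
      (titsSection s (Q.comp g.symm.toLinearMap) (g p)).ncard := by
  refine Set.ncard_le_ncard_of_injOn (Projectivization.map g.toLinearMap g.injective) ?_
    (Projectivization.map_injective _ g.injective).injOn (Set.toFinite _)
  intro P hP
  induction P using Projectivization.ind with
  | h v hv =>
    rw [mk_mem_titsSection] at hP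
    rw [Projectivization.map_mk, mk_mem_titsSection]
    exact ⟨(hg.onTits_iff v).2 hP.1, by simpa using hP.2.1, (hg.form_apply p v).trans hP.2.2⟩

omit [CharP F 2] in
theorem IsTitsSymmetry.polar_comp_symm {s : F →+* F} {g : (Fin 4 → F) ≃ₗ[F] (Fin 4 → F)}
    (hg : IsTitsSymmetry s g) {Q : QuadraticForm F (Fin 4 → F)} {n : F}
    (hQ : ∀ x y, QuadraticMap.polar Q x y = n * titsForm F x y) (x y : Fin 4 → F) :
    QuadraticMap.polar (Q.comp g.symm.toLinearMap) x y = n * titsForm F x y := by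
  have h : QuadraticMap.polar (Q.comp g.symm.toLinearMap) x y =
      QuadraticMap.polar Q (g.symm x) (g.symm y) := by
    simp [QuadraticMap.polar]
  rw [h, hQ, ← hg.form_apply]
  simp

omit [CharP F 2] in
/-- Tangent planes contain one point of the Suzuki–Tits ovoid. -/
theorem ncard_titsSection_infty_le [Finite F] {s : F →+* F} (Q : QuadraticForm F (Fin 4 → F))
    {c : F} (hc : c ≠ 0) : (titsSection s Q (c • titsInfty F)).ncard ≤ 1 := by
  have : titsSection s Q (c • titsInfty F) ⊆
      {Projectivization.mk F (titsInfty F) titsInfty_ne_zero} := by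
    intro P hP
    induction P using Projectivization.ind with
    | h v hv =>
      rw [mk_mem_titsSection] at hP
      obtain ⟨⟨-, ⟨x, y, d, rfl⟩ | ⟨d, rfl⟩⟩, -, h⟩ := hP
      · rw [map_smul, map_smul, LinearMap.smul_apply, smul_eq_mul, smul_eq_mul] at h
        have h1 : titsForm F (titsInfty F) (titsVec s x y) = 1 := by
          simp [titsForm_apply, titsInfty, titsVec]
        rw [h1, mul_one] at h
        exact absurd h (mul_ne_zero (left_ne_zero_of_smul hv) hc)
      · exact (Projectivization.mk_eq_mk_of_smul _ _ rfl).symm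
  simpa using Set.ncard_le_ncard this

/-- A plane section of the Suzuki–Tits ovoid that is the translation oval `(1, 0, t, s t)`
meets a quadric inducing the same symplectic form in at most four points. -/
theorem ncard_titsSection_translation_le [Finite F] {s : F →+* F} (hs : ∀ x, s (s x) = x ^ 2)
    {Q : QuadraticForm F (Fin 4 → F)} {n : F} (hn : n ≠ 0)
    (hQ : ∀ x y, QuadraticMap.polar Q x y = n * titsForm F x y) {c : F} (hc : c ≠ 0) :
    (titsSection s Q ![0, 0, c, 0]).ncard ≤ 4 := by
  classical
  set a := Q ![1, 0, 0, 0] with ha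
  set b := Q ![0, 0, 1, 0] with hb
  set d := Q (titsInfty F) with hd
  -- The only nonzero cross term pairs the first and last basis vectors. Writing `t ^ 2` as `s (s
  -- t)` makes `z = s t` the unknown.
  have hQt (t : F) : Q (titsVec s 0 t) = a + b * s (s t) + d * s t ^ 2 + n * s t := by
    have h1 : titsVec s 0 t = ![1, 0, 0, 0] + t • ![0, 0, 1, 0] + s t • titsInfty F := by
      ext i
      fin_cases i <;> simp [titsVec, titsInfty]
    rw [h1, QuadraticMap.map_add Q, QuadraticMap.map_add Q, QuadraticMap.map_smul,
      QuadraticMap.map_smul, hQ, hQ, hs, ← ha, ← hb, ← hd]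
    simp [titsForm_apply, titsInfty]
    ring
  set Z := {z : F | a + b * s z + d * z ^ 2 + n * z = 0} with hZ
  have hZc : Z.ncard ≤ if d = 0 then 2 else 4 := ncard_twisted_roots_le hs hn
  set f : F → PG F 4 := fun t => Projectivization.mk F (titsVec s 0 t) (titsVec_ne_zero s 0 t)
  have hfc : (f '' (s ⁻¹' Z)).ncard ≤ if d = 0 then 2 else 4 :=
    (Set.ncard_image_le (Set.toFinite _)).trans ((Set.ncard_le_ncard_of_injOn s (fun _ h => h)
      s.injective.injOn (Set.toFinite _)).trans hZc)
  have hsub : titsSection s Q ![0, 0, c, 0] ⊆ f '' (s ⁻¹' Z) ∪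
      {P | d = 0 ∧ P = Projectivization.mk F (titsInfty F) titsInfty_ne_zero} := by
    intro P hP
    induction P using Projectivization.ind with
    | h v hv =>
      rw [mk_mem_titsSection] at hP
      obtain ⟨⟨-, ⟨x, y, e, rfl⟩ | ⟨e, rfl⟩⟩, hQv, h⟩ := hP
      · have he := left_ne_zero_of_smul hv
        have hx : x = 0 := by
          rw [map_smul, smul_eq_mul] at h
          simpa [titsForm_apply, titsVec, he, hc] using h
        subst hx
        refine Or.inl ⟨y, ?_, Projectivization.mk_eq_mk_of_smul _ _ rfl⟩
        rw [QuadraticMap.map_smul, hQt, smul_eq_mul] at hQv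
        exact (mul_eq_zero.1 hQv).resolve_left (mul_ne_zero he he)
      · have he := left_ne_zero_of_smul hv
        rw [QuadraticMap.map_smul, ← hd, smul_eq_mul] at hQv
        exact Or.inr ⟨(mul_eq_zero.1 hQv).resolve_left (mul_ne_zero he he),
          (Projectivization.mk_eq_mk_of_smul _ _ rfl).symm⟩
  refine (Set.ncard_le_ncard hsub (Set.toFinite _)).trans ((Set.ncard_union_le _ _).trans ?_)
  by_cases h0 : d = 0
  · simp only [h0, true_and, if_true] at hfc ⊢
    have : {P : PG F 4 | P = Projectivization.mk F (titsInfty F) titsInfty_ne_zero}.ncard = 1 :=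
      Set.ncard_singleton _
    omega
  · simp only [h0, false_and, if_false] at hfc ⊢
    simpa using hfc

/-- Translations clear the coordinates after the first nonzero one, or after `p 2`. If `p 1 ≠ 0`,
this needs `s u = p 2 / p 1`, solvable because `s` is onto the finite field; reversal then moves `p
1` to index two. -/
theorem exists_symmetry_normalize [Finite F] {s : F →+* F} (hs : ∀ x, s (s x) = x ^ 2)
    {p : Fin 4 → F} (hp : p ≠ 0) (h0 : p 0 = 0) :
    ∃ g, IsTitsSymmetry s g ∧ ∃ c : F, c ≠ 0 ∧
      (g p = c • titsInfty F ∨ g p = ![0, 0, c, 0]) := by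
  have h2 : (2 : F) = 0 := CharTwo.two_eq_zero
  by_cases h1 : p 1 = 0
  · by_cases h3 : p 2 = 0
    · have hpe : p = p 3 • titsInfty F := by
        ext i
        fin_cases i <;> simp [titsInfty, h0, h1, h3]
      refine ⟨LinearEquiv.refl F _, ⟨fun _ => Iff.rfl, fun _ _ => rfl⟩, p 3, ?_, Or.inl hpe⟩
      intro h
      exact hp (by rw [hpe, h, zero_smul])
    · refine ⟨titsShift s (p 3 / p 2) 0, isTitsSymmetry_titsShift hs _ _, p 2, h3, Or.inr ?_⟩
      ext i
      fin_cases i <;> simp [titsShift_apply, h0, h1, h3]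
      exact CharTwo.add_self_eq_zero _
  · obtain ⟨u, hu⟩ := Finite.surjective_of_injective s.injective (p 2 / p 1)
    refine ⟨(titsShift s u ((p 3 + u * p 2) / p 1 - s u * u)).trans (titsSwap F),
      (isTitsSymmetry_titsShift hs _ _).trans (isTitsSymmetry_titsSwap hs), p 1, h1, Or.inr ?_⟩
    ext i
    fin_cases i
    · simp [titsShift_apply, titsSwap_apply, h0, h1]
      exact CharTwo.add_self_eq_zero _
    · simp [titsShift_apply, titsSwap_apply, h0, h1, hu]
      exact CharTwo.add_self_eq_zero _
    · simp [titsShift_apply, titsSwap_apply, h0]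
    · simp [titsShift_apply, titsSwap_apply, h0]

/-- A plane contains at most four singular points of a quadratic form polarizing to a multiple of
`titsForm` on the Suzuki–Tits ovoid. -/
theorem ncard_titsSection_le [Finite F] {s : F →+* F} (hs : ∀ x, s (s x) = x ^ 2)
    {Q : QuadraticForm F (Fin 4 → F)} {n : F} (hn : n ≠ 0)
    (hQ : ∀ x y, QuadraticMap.polar Q x y = n * titsForm F x y) {p : Fin 4 → F} (hp : p ≠ 0) :
    (titsSection s Q p).ncard ≤ 4 := by
  have haux {Q : QuadraticForm F (Fin 4 → F)}
      (hQ : ∀ x y, QuadraticMap.polar Q x y = n * titsForm F x y) {p : Fin 4 → F} (hp : p ≠ 0)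
      (h0 : p 0 = 0) : (titsSection s Q p).ncard ≤ 4 := by
    obtain ⟨g, hg, c, hc, h | h⟩ := exists_symmetry_normalize hs hp h0
    · refine (hg.ncard_titsSection_le Q p).trans ?_
      rw [h]
      exact (ncard_titsSection_infty_le _ hc).trans (by norm_num)
    · refine (hg.ncard_titsSection_le Q p).trans ?_
      rw [h]
      exact ncard_titsSection_translation_le hs hn (hg.polar_comp_symm hQ) hc
  rcases (titsSection s Q p).eq_empty_or_nonempty with h | ⟨P, hP, -, hPp⟩
  · simp [h]
  -- Sending a point of the section to infinity turns its orthogonality to `p` into the vanishing of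
  -- coordinate zero.
  obtain ⟨g, hg, c, hc, hgP⟩ := hP.exists_symmetry hs
  refine (hg.ncard_titsSection_le Q p).trans (haux (hg.polar_comp_symm hQ) ?_ ?_)
  · simpa using hp
  · rw [← hg.form_apply, hgP, map_smul, smul_eq_mul] at hPp
    have := (mul_eq_zero.1 hPp).resolve_left hc
    simpa [titsForm_apply, titsInfty] using this

end Count

/-! ### Coplanar points of an elliptic quadric and NMDS-sets. -/

section NMDS

variable {F : Type*} [Field F]

/-- On `a • u + b • v` the form equals `a * b * polar Q u v`, and the polar value is nonzero by Witt
index one. -/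
theorem IsEllipticForm.notMem_span_pair {Q : QuadraticForm F (Fin 4 → F)}
    (hQ : IsEllipticForm Q) {u v w : Fin 4 → F} (hu : u ≠ 0) (hQu : Q u = 0)
    (hQv : Q v = 0) (hQw : Q w = 0) (huv : ∀ c : F, v ≠ c • u) (huw : ∀ c : F, w ≠ c • u)
    (hvw : ∀ c : F, w ≠ c • v) : w ∉ Submodule.span F {u, v} := by
  intro hw
  obtain ⟨a, b, rfl⟩ := Submodule.mem_span_pair.1 hw
  have ha : a ≠ 0 := by
    rintro rfl
    exact hvw b (by simp)
  have hb : b ≠ 0 := by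
    rintro rfl
    exact huw a (by simp)
  rw [QuadraticMap.map_add Q, QuadraticMap.map_smul, QuadraticMap.map_smul, hQu, hQv,
    QuadraticMap.polar_smul_left, QuadraticMap.polar_smul_right] at hQw
  simp only [smul_eq_mul, mul_zero, add_zero, zero_add, mul_eq_zero, ha, hb, false_or] at hQw
  obtain ⟨c, hc⟩ := hQ.exists_smul_of_polar_eq_zero hu hQu hQv hQw
  exact huv c hc

theorem Projectivization.rep_ne_smul {V : Type*} [AddCommGroup V] [Module F V] {P R : ℙ F V}
    (h : P ≠ R) (c : F) : R.rep ≠ c • P.rep := fun hc => h <| by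
  rw [← P.mk_rep, ← R.mk_rep]
  exact Projectivization.mk_eq_mk_of_smul _ _ hc

theorem Projectivization.submodule_le_iff_rep_mem {V : Type*} [AddCommGroup V] [Module F V]
    (P : ℙ F V) (W : Submodule F V) : P.submodule ≤ W ↔ P.rep ∈ W := by
  rw [Projectivization.submodule_eq, Submodule.span_singleton_le_iff_mem]

variable {Q : QuadraticForm F (Fin 4 → F)} {X : Set (PG F 4)}

theorem IsEllipticForm.rep_notMem_span_pair (hQ : IsEllipticForm Q)
    (hX : X ⊆ {P | ∀ v ∈ P.submodule, Q v = 0}) {P R A : PG F 4} (hP : P ∈ X) (hR : R ∈ X)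
    (hA : A ∈ X) (hPR : P ≠ R) (hPA : P ≠ A) (hRA : R ≠ A) :
    A.rep ∉ Submodule.span F {P.rep, R.rep} := by
  have hrep {P : PG F 4} (hP : P ∈ X) : Q P.rep = 0 :=
    hX hP _ ((Projectivization.submodule_le_iff_rep_mem P _).1 le_rfl)
  exact hQ.notMem_span_pair P.rep_nonzero (hrep hP) (hrep hR) (hrep hA)
    (Projectivization.rep_ne_smul hPR) (Projectivization.rep_ne_smul hPA)
    (Projectivization.rep_ne_smul hRA)

/-- Three points of an elliptic quadric generate a plane. -/
theorem IsEllipticForm.finrank_sup (hQ : IsEllipticForm Q)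
    (hX : X ⊆ {P | ∀ v ∈ P.submodule, Q v = 0}) {P R A : PG F 4} (hP : P ∈ X) (hR : R ∈ X)
    (hA : A ∈ X) (hPR : P ≠ R) (hPA : P ≠ A) (hRA : R ≠ A) :
    Module.finrank F ↥(Submodule.span F {P.rep, R.rep} ⊔ Submodule.span F {A.rep}) = 3 := by
  have h2 := finrank_span_pair_of_forall_ne_smul P.rep_nonzero (Projectivization.rep_ne_smul hPR)
  have h1 := finrank_span_singleton (K := F) A.rep_nonzero
  have hlt : Submodule.span F {P.rep, R.rep} <
      Submodule.span F {P.rep, R.rep} ⊔ Submodule.span F {A.rep} := by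
    refine lt_of_le_of_ne le_sup_left fun h => ?_
    apply hQ.rep_notMem_span_pair hX hP hR hA hPR hPA hRA
    rw [h]
    exact le_sup_right (a := Submodule.span F {P.rep, R.rep}) (Submodule.mem_span_singleton_self _)
  have h3 := Submodule.finrank_lt_finrank_of_lt hlt
  have h4 := Submodule.finrank_add_le_finrank_add_finrank (Submodule.span F {P.rep, R.rep})
    (Submodule.span F {A.rep})
  omega

/-- A set of more than `q + 3` points of an elliptic quadric contains four coplanar points. -/
theorem IsEllipticForm.exists_coplanar [Finite F] (hQ : IsEllipticForm Q)
    (hX : X ⊆ {P | ∀ v ∈ P.submodule, Q v = 0}) (hcard : Nat.card F + 3 < X.ncard) :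
    ∃ S : Finset (PG F 4), (S : Set (PG F 4)) ⊆ X ∧ S.card = 4 ∧
      ∃ H : Submodule F (Fin 4 → F), Module.finrank F H = 3 ∧ ∀ P ∈ S, P.submodule ≤ H := by
  classical
  obtain ⟨P, hP, R, hR, hPR⟩ := (Set.one_lt_ncard (Set.toFinite X)).1 (by omega)
  set L := Submodule.span F {P.rep, R.rep} with hL
  have hLr : Module.finrank F L = 2 :=
    finrank_span_pair_of_forall_ne_smul P.rep_nonzero (Projectivization.rep_ne_smul hPR)
  have hquot : Module.finrank F ((Fin 4 → F) ⧸ L) = 2 := by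
    have := Submodule.finrank_quotient_add_finrank L
    rw [hLr, Module.finrank_fin_fun] at this
    omega
  have hline : Nat.card (ℙ F ((Fin 4 → F) ⧸ L)) = Nat.card F + 1 := by
    rw [Projectivization.card_of_finrank F _ hquot]
    simp [Finset.sum_range_succ, add_comm]
  have hne (A : ↥(X \ {P, R})) : L.mkQ (A : PG F 4).rep ≠ 0 := by
    obtain ⟨A, hA, hA'⟩ := A
    simp only [Set.mem_insert_iff, Set.mem_singleton_iff, not_or] at hA'
    rw [Submodule.mkQ_apply, Ne, Submodule.Quotient.mk_eq_zero]
    exact hQ.rep_notMem_span_pair hX hP hR hA hPR (Ne.symm hA'.1) (Ne.symm hA'.2)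
  -- Projection from the secant `L`: more than `q + 1` remaining points map to a line with `q + 1`
  -- points, and two points with equal image lie in one plane through `L`.
  let f : ↥(X \ {P, R}) → ℙ F ((Fin 4 → F) ⧸ L) := fun A => Projectivization.mk F _ (hne A)
  have hf : ¬ Function.Injective f := by
    intro hinj
    have : Finite ((Fin 4 → F) ⧸ L) := Module.finite_of_finite F
    have h1 := Nat.card_le_card_of_injective f hinj
    rw [hline, Nat.card_coe_set_eq, Set.ncard_sdiff (Set.insert_subset hP (by simpa using hR)),
      Set.ncard_pair hPR] at h1
    omega
  simp only [Function.Injective, not_forall] at hf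
  obtain ⟨⟨A, hA, hA'⟩, ⟨C, hC, hC'⟩, hAC, hne'⟩ := hf
  have hAC' : A ≠ C := fun h => hne' (Subtype.ext h)
  simp only [Set.mem_insert_iff, Set.mem_singleton_iff, not_or] at hA' hC'
  obtain ⟨a, ha⟩ := (Projectivization.mk_eq_mk_iff' ..).1 hAC
  simp only [Submodule.mkQ_apply, ← Submodule.Quotient.mk_smul] at ha
  rw [Submodule.Quotient.eq] at ha
  refine ⟨{P, R, A, C}, ?_, ?_, L ⊔ Submodule.span F {C.rep},
    hQ.finrank_sup hX hP hR hC hPR (Ne.symm hC'.1) (Ne.symm hC'.2), ?_⟩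
  · intro D hD
    simp only [Finset.coe_insert, Finset.coe_singleton, Set.mem_insert_iff,
      Set.mem_singleton_iff] at hD
    rcases hD with rfl | rfl | rfl | rfl <;> assumption
  · rw [Finset.card_insert_of_notMem, Finset.card_insert_of_notMem, Finset.card_insert_of_notMem,
      Finset.card_singleton]
    · simpa using hAC'
    · simpa using ⟨Ne.symm hA'.2, Ne.symm hC'.2⟩
    · simpa using ⟨hPR, Ne.symm hA'.1, Ne.symm hC'.1⟩
  · have hPL : P.rep ∈ L := Submodule.subset_span (by simp)
    have hRL : R.rep ∈ L := Submodule.subset_span (by simp)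
    have hCH : C.rep ∈ L ⊔ Submodule.span F {C.rep} :=
      le_sup_right (a := L) (Submodule.mem_span_singleton_self _)
    intro D hD
    rw [Projectivization.submodule_le_iff_rep_mem]
    simp only [Finset.mem_insert, Finset.mem_singleton] at hD
    rcases hD with rfl | rfl | rfl | rfl
    · exact le_sup_left (b := Submodule.span F {C.rep}) hPL
    · exact le_sup_left (b := Submodule.span F {C.rep}) hRL
    · simpa using sub_mem (Submodule.smul_mem _ a hCH)
        (le_sup_left (b := Submodule.span F {C.rep}) ha)
    · exact hCH

theorem ncard_le_pointsIn [Finite F] {S : Finset (PG F 4)} (hS : (S : Set (PG F 4)) ⊆ X)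
    {H : Submodule F (Fin 4 → F)} (hH : ∀ P ∈ S, P.submodule ≤ H) :
    S.card ≤ (pointsIn X H).ncard := by
  rw [← Set.ncard_coe_finset]
  exact Set.ncard_le_ncard (fun P hP => ⟨hS hP, hH P hP⟩) (Set.toFinite _)

/-- A set of more than `q + 3` points of an elliptic quadric with at most four points in each
plane is an NMDS-set. -/
theorem IsEllipticForm.isNMDSSet [Finite F] (hQ : IsEllipticForm Q)
    (hX : X ⊆ {P | ∀ v ∈ P.submodule, Q v = 0}) (hcard : Nat.card F + 3 < X.ncard)
    (hplane : ∀ W : Submodule F (Fin 4 → F), Module.finrank F W = 3 →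
      (pointsIn X W).ncard ≤ 4) : IsNMDSSet X where
  generate_hyperplane S hS hS3 := by
    classical
    obtain ⟨P, R, A, hPR, hPA, hRA, rfl⟩ := Finset.card_eq_three.1 (by omega : S.card = 3)
    simp only [Finset.coe_insert, Finset.coe_singleton, Set.insert_subset_iff,
      Set.singleton_subset_iff] at hS
    have hgen : generated (({P, R, A} : Finset (PG F 4)) : Set (PG F 4)) =
        Submodule.span F {P.rep, R.rep} ⊔ Submodule.span F {A.rep} := by
      simp only [generated, Finset.coe_insert, Finset.coe_singleton, iSup_insert, iSup_singleton,
        Projectivization.submodule_eq, Submodule.span_insert P.rep, sup_assoc]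
    rw [hgen, hQ.finrank_sup hX hS.1 hS.2.1 hS.2.2 hPR hPA hRA]
  exists_on_hyperplane := by
    obtain ⟨S, hS, hS4, H, hH, hSH⟩ := hQ.exists_coplanar hX hcard
    exact ⟨S, hS, hS4, H, by omega, hSH⟩
  generate_top S hS hS5 := by
    by_contra h
    obtain ⟨f, hf, hle⟩ := Submodule.exists_le_ker_of_lt_top _ (lt_top_iff_ne_top.2 h)
    have hker := Module.Dual.finrank_ker_add_one_of_ne_zero hf
    rw [Module.finrank_fin_fun] at hker
    have h1 := hplane (LinearMap.ker f) (by omega)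
    have h2 := ncard_le_pointsIn hS (H := LinearMap.ker f)
      fun P hP => (le_iSup₂_of_le (f := fun (P : PG F 4) (_ : P ∈ (S : Set (PG F 4))) =>
        P.submodule) P hP le_rfl).trans hle
    omega

end NMDS

/-! ### Transfer to canonical coordinates and conclusion. -/

section Main

variable {F : Type*} [Field F]

theorem charP_two_of_card [Finite F] {n : ℕ} (h : Nat.card F = 2 ^ n) : CharP F 2 := by
  have := Fintype.ofFinite F
  have h0 := FiniteField.cast_card_eq_zero F
  rw [← Nat.card_eq_fintype_card, h, Nat.cast_pow] at h0
  exact CharTwo.of_one_ne_zero_of_two_eq_zero one_ne_zero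
    (by exact_mod_cast eq_zero_of_pow_eq_zero h0)

/-- Here `σ ^ 2 = 2 ^ (2 * r + 2) = 2 * q`, and `x ^ q = x`. -/
theorem iterateFrobenius_iterateFrobenius [Finite F] [CharP F 2] {r : ℕ}
    (h : Nat.card F = 2 ^ (2 * r + 1)) (x : F) :
    iterateFrobenius F 2 (r + 1) (iterateFrobenius F 2 (r + 1) x) = x ^ 2 := by
  have := Fintype.ofFinite F
  have hx := FiniteField.pow_card x
  rw [← Nat.card_eq_fintype_card, h] at hx
  rw [iterateFrobenius_def, iterateFrobenius_def, ← pow_mul, ← pow_add,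
    show r + 1 + (r + 1) = 2 * r + 1 + 1 by ring, pow_succ, pow_mul, hx]

theorem onTits_of_mem_canonicalSuzukiTits [CharP F 2] {r : ℕ} {v : Fin 4 → F} (hv : v ≠ 0) :
    Projectivization.mk F v hv ∈ canonicalSuzukiTits F r ↔
      OnTits (iterateFrobenius F 2 (r + 1)) v := by
  have hspan {w : Fin 4 → F} : Submodule.span F {v} = Submodule.span F {w} ↔
      ∃ c : F, v = c • w := by
    constructor
    · intro h
      have : v ∈ Submodule.span F {w} := h ▸ Submodule.mem_span_singleton_self v
      obtain ⟨c, hc⟩ := Submodule.mem_span_singleton.1 this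
      exact ⟨c, hc.symm⟩
    · rintro ⟨c, rfl⟩
      exact Submodule.span_singleton_smul_eq (left_ne_zero_of_smul hv).isUnit w
  have hneg (x y z : F) : x * y + x ^ (2 ^ (r + 1) + 2) + y ^ 2 ^ (r + 1) + z = 0 ↔
      z = x * y + iterateFrobenius F 2 (r + 1) x * x ^ 2 + iterateFrobenius F 2 (r + 1) y := by
    rw [iterateFrobenius_def, iterateFrobenius_def, ← pow_add, CharTwo.add_eq_zero, eq_comm]
  simp only [canonicalSuzukiTits, Set.mem_union, Set.mem_ofPred_eq, Projectivization.submodule_mk,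
    hspan, hneg, OnTits, ne_eq, hv, not_false_eq_true, true_and, titsVec, titsInfty]
  simp

theorem exists_titsForm_eq (f : Module.Dual F (Fin 4 → F)) (hf : f ≠ 0) :
    ∃ p, p ≠ 0 ∧ ∀ x, titsForm F p x = f x := by
  have h (x : Fin 4 → F) : titsForm F ![f (Pi.single 3 1), f (Pi.single 2 1), f (Pi.single 1 1),
      f (Pi.single 0 1)] x = f x := by
    conv_rhs => rw [LinearMap.pi_apply_eq_sum_univ f x]
    have hsingle (i : Fin 4) : (fun j => if i = j then (1 : F) else 0) = Pi.single i 1 := by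
      ext j
      simp [Pi.single_apply, eq_comm]
    simp only [hsingle, Fin.sum_univ_four, titsForm_apply, smul_eq_mul, Matrix.cons_val]
    ring
  refine ⟨_, fun h0 => hf ?_, h⟩
  refine LinearMap.ext fun x => ?_
  rw [← h, h0]
  simp

/-- Pulling back along `g` makes `T` canonical; `titsForm` and the polar form of `Q` are then `c`
and `d` times the same pulled-back `B`, so their ratio `d / c` plays the role of `n`. -/
theorem ncard_pointsIn_inter_le [Finite F] [CharP F 2] {r : ℕ}
    (hF : Nat.card F = 2 ^ (2 * r + 1)) {B : LinearMap.BilinForm F (Fin 4 → F)}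
    (hB : B.IsAlt) {Q : QuadraticForm F (Fin 4 → F)} (hQ : IsEllipticForm Q)
    (hE : IsOvoid B {P | ∀ v ∈ P.submodule, Q v = 0}) {T : Set (PG F 4)}
    (hT : IsSuzukiTitsOvoid r B T) {W : Submodule F (Fin 4 → F)} (hW : Module.finrank F W = 3) :
    (pointsIn ({P | ∀ v ∈ P.submodule, Q v = 0} ∩ T) W).ncard ≤ 4 := by
  have hs := iterateFrobenius_iterateFrobenius hF
  obtain ⟨g, hg⟩ := hT.equivalent
  obtain ⟨c, hc⟩ := titsForm_eq_mul hs (B := B.compl₁₂ g.toLinearMap g.toLinearMap)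
    (fun x => by simpa using hB.self_eq_zero (g x)) (by
      intro u v hu hv huv
      have hmem {u : Fin 4 → F} (hu : OnTits (iterateFrobenius F 2 (r + 1)) u) :
          Projectivization.mk F (g u) (by simpa using hu.1) ∈ T := by
        rw [hg]
        exact ⟨_, (onTits_of_mem_canonicalSuzukiTits hu.1).2 hu, Projectivization.map_mk ..⟩
      obtain ⟨a, ha⟩ := hT.isOvoid.exists_smul_of_perp hB _ _ (hmem hu) (hmem hv)
        (by simpa using huv)
      exact ⟨a, g.injective (by rw [ha, map_smul])⟩)
  obtain ⟨d, hd⟩ := hE.polar_eq_mul hB hQ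
  simp only [LinearMap.compl₁₂_apply, LinearEquiv.coe_coe] at hc
  have hc0 : c ≠ 0 := by
    rintro rfl
    have := hc ![1, 0, 0, 0] ![0, 0, 0, 1]
    simp [titsForm_apply] at this
  have hd0 : d ≠ 0 := by
    rintro rfl
    obtain ⟨u, hu, -⟩ := hQ.exists_singular
    exact hu (hQ.nondegenerate.1 u fun y => by simp [hd])
  have hlt : W < ⊤ := by
    refine lt_top_iff_ne_top.2 fun h => ?_
    rw [h, finrank_top, Module.finrank_fin_fun] at hW
    omega
  obtain ⟨f, hf, hWf⟩ := Submodule.exists_le_ker_of_lt_top _ hlt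
  obtain ⟨p, hp, hpf⟩ := exists_titsForm_eq (f.comp g.toLinearMap) (fun h => hf <|
    LinearMap.ext fun x => by simpa using LinearMap.congr_fun h (g.symm x))
  have hpol (x y : Fin 4 → F) : QuadraticMap.polar (Q.comp g.toLinearMap) x y =
      d / c * titsForm F x y := by
    have h : QuadraticMap.polar (Q.comp g.toLinearMap) x y = QuadraticMap.polar Q (g x) (g y) := by
      simp [QuadraticMap.polar]
    rw [h, hd, hc]
    field_simp
  have hsec := ncard_titsSection_le hs (div_ne_zero hd0 hc0) hpol hp
  refine le_trans (le_trans (Set.ncard_le_ncard ?_ (Set.toFinite _)) (Set.ncard_image_le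
    (f := Projectivization.map g.toLinearMap g.injective) (Set.toFinite _))) hsec
  rintro P ⟨⟨hPE, hPT⟩, hPW⟩
  rw [hg] at hPT
  obtain ⟨R, hR, rfl⟩ := hPT
  refine ⟨R, ?_, rfl⟩
  induction R using Projectivization.ind with
  | h v hv =>
    rw [Projectivization.map_mk, Projectivization.submodule_mk,
      Submodule.span_singleton_le_iff_mem] at hPW
    rw [Projectivization.map_mk, mk_mem_zeroSet] at hPE
    rw [mk_mem_titsSection]
    exact ⟨(onTits_of_mem_canonicalSuzukiTits hv).1 hR, by simpa using hPE, by
      rw [hpf]; exact hWf hPW⟩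

end Main

theorem mainTheorem2 (r q : ℕ) (hr : 1 ≤ r) (hq : q = 2 ^ (2 * r + 1))
    (F : Type*) [Field F] [Finite F] (hF : Nat.card F = q)
    (B : LinearMap.BilinForm F (Fin 4 → F)) (hB : IsSymplectic B)
    (E T : Set (PG F 4)) (hE : IsEllipticOvoid B E) (hT : IsSuzukiTitsOvoid r B T) :
    (∀ W : Submodule F (Fin 4 → F), Module.finrank F W = 3 →
      (pointsIn (E ∩ T) W).ncard ≤ 4) ∧
    (((E ∩ T).ncard : ℝ) = (q : ℝ) + Real.sqrt (2 * (q : ℝ)) + 1 →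
      IsNMDSSet (E ∩ T) ∧
      ∃ W : Submodule F (Fin 4 → F), Module.finrank F W = 3 ∧
        (pointsIn (E ∩ T) W).ncard = 4) := by
  have hF' : Nat.card F = 2 ^ (2 * r + 1) := hF.trans hq
  have hchar := charP_two_of_card hF'
  obtain ⟨hO, Q, hQ, rfl⟩ := hE
  have hplane (W : Submodule F (Fin 4 → F)) (hW : Module.finrank F W = 3) :=
    ncard_pointsIn_inter_le hF' hB.alt hQ hO hT hW
  refine ⟨hplane, fun hcard => ?_⟩
  have hsqrt : Real.sqrt (2 * (q : ℝ)) = 2 ^ (r + 1) := by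
    rw [show 2 * (q : ℝ) = (2 ^ (r + 1)) ^ 2 by rw [hq]; push_cast; ring]
    exact Real.sqrt_sq (by positivity)
  rw [hsqrt] at hcard
  have hcard' : ({P : PG F 4 | ∀ v ∈ P.submodule, Q v = 0} ∩ T).ncard = q + 2 ^ (r + 1) + 1 := by
    exact_mod_cast hcard
  -- Since `r ≥ 1`, the intersection has at least `q + 5` points, above the threshold `q + 3`.
  have hpow : 2 ^ 2 ≤ 2 ^ (r + 1) := Nat.pow_le_pow_right (by norm_num) (by omega)
  have hlarge : Nat.card F + 3 < ({P : PG F 4 | ∀ v ∈ P.submodule, Q v = 0} ∩ T).ncard := by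
    omega
  have hsub : {P : PG F 4 | ∀ v ∈ P.submodule, Q v = 0} ∩ T ⊆
      {P | ∀ v ∈ P.submodule, Q v = 0} := Set.inter_subset_left
  refine ⟨hQ.isNMDSSet hsub hlarge hplane, ?_⟩
  obtain ⟨S, hS, hS4, H, hH, hSH⟩ := hQ.exists_coplanar hsub hlarge
  exact ⟨H, hH, le_antisymm (hplane H hH) (hS4.ge.trans (ncard_le_pointsIn hS hSH))⟩
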